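/- Let $d\ge 1$. For $f:\mathbb R^d\to\mathbb R$ integrable put $\widehat f(y)=\int_{\mathbb R^d}f(x)e^{-2\pi i x\cdot y}\,dx$. For $f:\mathbb R^d\to\mathbb R$ put $A(f)=\inf\{r>0: f(x)\ge 0 \text{ for all } |x|>r\}\in[0,\infty]$, with $\inf\emptyset=\infty$. Let $\mathcal A$ be the set of all nonzero, continuous, even, integrable functions $f:\mathbb R^d\to\mathbb R$ such that $\widehat f$ (which is then real-valued) is integrable, $f(0)\le 0$ and $\widehat f(0)\le 0$, and let $$\mathbf A=\inf_{f\in\mathcal A}\sqrt{A(f)A(\widehat f)}.$$ Say that a continuous function $f:[0,\infty)\to\mathbb R$ has a double root at $x_0$ if $f(x_0)=0$ and there is a neighbourhood of $x_0$ on which $f\ge 0$ or on which $f\le 0$. **Theorem.** Let $f:[0,\infty)\to\mathbb R$ be a function whose radial extension $F(x)=f(|x|)$, $x\in\mathbb R^d$, belongs to $\mathcal A$ and satisfies $A(F)A(\widehat F)=\mathbf A^2$. Then $f$ has infinitely many double roots in the interval $(A(f),\infty)$, where $A(f):=A(F)$. -/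

import Mathlib

open MeasureTheory
open scoped FourierTransform NNReal ENNReal Topology

noncomputable section

/-- The Fourier transform `∫ f(x) exp(-2πi x·y) dx` of a real-valued function on `ℝ^d`, as a
complex-valued function. -/
def complexFourier {d : ℕ} (f : EuclideanSpace ℝ (Fin d) → ℝ) :
    EuclideanSpace ℝ (Fin d) → ℂ :=
  𝓕 (fun x => (f x : ℂ))

/-- The Fourier transform of an even real-valued function, as a real-valued function. For even
functions no information is lost by taking the real part: see `coe_realFourier`. -/
def realFourier {d : ℕ} (f : EuclideanSpace ℝ (Fin d) → ℝ) :
    EuclideanSpace ℝ (Fin d) → ℝ :=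
  fun y => (complexFourier f y).re

/-- The Fourier transform of an even real-valued function is real-valued. -/
theorem coe_realFourier {d : ℕ} {f : EuclideanSpace ℝ (Fin d) → ℝ}
    (hf : ∀ x, f (-x) = f x) (y : EuclideanSpace ℝ (Fin d)) :
    (realFourier f y : ℂ) = complexFourier f y := by
  have h : (starRingEnd ℂ) (complexFourier f y) = complexFourier f y := by
    unfold complexFourier
    rw [Real.fourier_eq', ← integral_conj,
      ← integral_neg_eq_self (μ := (volume : Measure (EuclideanSpace ℝ (Fin d))))]
    congr 1
    ext x
    simp [hf, ← Complex.exp_conj, Complex.conj_ofNat]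
  exact Complex.conj_eq_iff_re.mp h

/-- `A(f) = inf {r > 0 : f(x) ≥ 0 whenever |x| > r}`, with value `∞` if there is no such `r`. -/
def nonnegRadius {d : ℕ} (f : EuclideanSpace ℝ (Fin d) → ℝ) : ℝ≥0∞ :=
  ⨅ (r : ℝ≥0) (_ : 0 < r ∧ ∀ x, (r : ℝ) < ‖x‖ → 0 ≤ f x), (r : ℝ≥0∞)

/-- The class `𝒜` of functions on `ℝ^d`. An integrable function with integrable Fourier transform
is identified with its continuous representative, so that its value at `0` makes sense; evenness
makes the Fourier transform real-valued. -/
structure Admissible {d : ℕ} (f : EuclideanSpace ℝ (Fin d) → ℝ) : Prop where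
  continuous : Continuous f
  even : ∀ x, f (-x) = f x
  ne_zero : f ≠ 0
  integrable : Integrable f
  integrable_fourier : Integrable (complexFourier f)
  apply_zero_nonpos : f 0 ≤ 0
  fourier_zero_nonpos : realFourier f 0 ≤ 0

/-- The sharp constant `𝐀 = inf_{f ∈ 𝒜} √(A(f) A(f̂))` in dimension `d`. -/
def sharpConst (d : ℕ) : ℝ≥0∞ :=
  ⨅ (f : EuclideanSpace ℝ (Fin d) → ℝ) (_ : Admissible f),
    (nonnegRadius f * nonnegRadius (realFourier f)) ^ (1 / 2 : ℝ)

/-- The radial extension `x ↦ f(|x|)` to `ℝ^d` of a function on the half-line. -/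
def radialExtension (d : ℕ) (f : ℝ≥0 → ℝ) : EuclideanSpace ℝ (Fin d) → ℝ :=
  fun x => f ‖x‖₊

/-- `f` has a double root at `x₀`: it vanishes there, and does not change sign in a neighbourhood
of `x₀`. -/
def IsDoubleRoot (f : ℝ≥0 → ℝ) (x₀ : ℝ≥0) : Prop :=
  f x₀ = 0 ∧ ((∀ᶠ x in 𝓝 x₀, 0 ≤ f x) ∨ (∀ᶠ x in 𝓝 x₀, f x ≤ 0))

end

open Filter Set

/-! Suppose there are only finitely many double roots beyond `A(F)`. Since `F` is nonnegative there,
every zero beyond `A(F)` is a double root. Dilate `F` so that it and its transform have the same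
radius `s = 𝐀`, and add the two: the sum `g` is self-dual, `g 0 ≤ 0`, `g ≥ 0` for `|x| > s`, and it
vanishes there on finitely many spheres only, because both summands are nonnegative
(`Admissible.comp_smul`).

Now perturb to `g + εh`, where `h` is radial and self-dual, `h 0 ≤ 0`, and `h` is positive on those
spheres, on `|x| = s` and near infinity (`exists_fourierSelfDual_pos`). For small `ε` the
perturbation is strictly positive on `|x| ≥ s`, hence also slightly inside, which beats the infimum
`𝐀` (`FourierSelfDual.sharpConst_lt`).

The function `h` comes from Gaussians symmetrized under the Fourier transform: their values at
finitely many radii can be prescribed, since evaluations at distinct radii are linearly independent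
on this family. -/

/-- An even continuous integrable function that is its own Fourier transform. -/
structure FourierSelfDual {d : ℕ} (g : EuclideanSpace ℝ (Fin d) → ℝ) : Prop where
  continuous : Continuous g
  even : ∀ x, g (-x) = g x
  integrable : Integrable g
  fourier : complexFourier g = fun x => (g x : ℂ)

/-! ### Fourier transform and self-dual functions -/

theorem complexFourier_add {d : ℕ} {f g : EuclideanSpace ℝ (Fin d) → ℝ}
    (hf : Integrable f) (hg : Integrable g) (y : EuclideanSpace ℝ (Fin d)) :
    complexFourier (fun x => f x + g x) y = complexFourier f y + complexFourier g y := by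
  simp only [complexFourier, Real.fourier_eq]
  rw [← integral_add ((Real.fourierIntegral_convergent_iff y).2 hf.ofReal)
    ((Real.fourierIntegral_convergent_iff y).2 hg.ofReal)]
  congr 1
  ext x
  rw [← smul_add, Complex.ofReal_add]

theorem complexFourier_const_mul {d : ℕ} (c : ℝ) (f : EuclideanSpace ℝ (Fin d) → ℝ)
    (y : EuclideanSpace ℝ (Fin d)) :
    complexFourier (fun x => c * f x) y = c * complexFourier f y := by
  simp only [complexFourier, Real.fourier_eq', ← integral_const_mul]
  congr 1
  ext x
  simp only [smul_eq_mul, Complex.ofReal_mul]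
  ring

theorem continuous_complexFourier {d : ℕ} {f : EuclideanSpace ℝ (Fin d) → ℝ}
    (hf : Integrable f) : Continuous (complexFourier f) :=
  VectorFourier.fourierIntegral_continuous Real.continuous_fourierChar
    (L := innerₗ (EuclideanSpace ℝ (Fin d))) (by exact continuous_inner) hf.ofReal

theorem complexFourier_neg {d : ℕ} {f : EuclideanSpace ℝ (Fin d) → ℝ}
    (hf : ∀ x, f (-x) = f x) (y : EuclideanSpace ℝ (Fin d)) :
    complexFourier f (-y) = complexFourier f y := by
  simp only [complexFourier]
  rw [← Real.fourierInv_eq_fourier_neg, Real.fourierInv_eq_fourier_comp_neg]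
  simp [hf]

theorem complexFourier_realFourier {d : ℕ} {f : EuclideanSpace ℝ (Fin d) → ℝ}
    (hc : Continuous f) (hf : ∀ x, f (-x) = f x) (hi : Integrable f)
    (hi' : Integrable (complexFourier f)) (y : EuclideanSpace ℝ (Fin d)) :
    complexFourier (realFourier f) y = f y := by
  have h1 : (fun x => (realFourier f x : ℂ)) = complexFourier f :=
    funext (coe_realFourier hf)
  have h2 : 𝓕⁻ (𝓕 (fun x => (f x : ℂ))) = fun x => (f x : ℂ) :=
    (Complex.continuous_ofReal.comp hc).fourierInv_fourier_eq hi.ofReal hi'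
  have h3 := congrFun h2 (-y)
  rw [Real.fourierInv_eq_fourier_neg, neg_neg, hf] at h3
  rw [← h3, complexFourier, h1]
  rfl

theorem FourierSelfDual.add {d : ℕ} {f g : EuclideanSpace ℝ (Fin d) → ℝ}
    (hf : FourierSelfDual f) (hg : FourierSelfDual g) :
    FourierSelfDual (fun x => f x + g x) where
  continuous := hf.continuous.add hg.continuous
  even x := by rw [hf.even, hg.even]
  integrable := hf.integrable.add hg.integrable
  fourier := by
    ext y
    rw [complexFourier_add hf.integrable hg.integrable, hf.fourier, hg.fourier]
    simp

theorem FourierSelfDual.const_mul {d : ℕ} {f : EuclideanSpace ℝ (Fin d) → ℝ} (c : ℝ)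
    (hf : FourierSelfDual f) : FourierSelfDual (fun x => c * f x) where
  continuous := hf.continuous.const_mul c
  even x := by rw [hf.even]
  integrable := hf.integrable.const_mul c
  fourier := by
    ext y
    rw [complexFourier_const_mul, hf.fourier]
    simp

theorem FourierSelfDual.realFourier_eq {d : ℕ} {f : EuclideanSpace ℝ (Fin d) → ℝ}
    (hf : FourierSelfDual f) : realFourier f = f := by
  ext x
  simp [realFourier, hf.fourier]

theorem FourierSelfDual.admissible {d : ℕ} {f : EuclideanSpace ℝ (Fin d) → ℝ}
    (hf : FourierSelfDual f) (h0 : f 0 ≤ 0) (hne : f ≠ 0) : Admissible f where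
  continuous := hf.continuous
  even := hf.even
  ne_zero := hne
  integrable := hf.integrable
  integrable_fourier := by rw [hf.fourier]; exact hf.integrable.ofReal
  apply_zero_nonpos := h0
  fourier_zero_nonpos := by rw [hf.realFourier_eq]; exact h0

/-- By inversion and evenness the transform is an involution on such functions, so it swaps the two
summands. -/
theorem FourierSelfDual.add_realFourier {d : ℕ} {f : EuclideanSpace ℝ (Fin d) → ℝ}
    (hc : Continuous f) (hf : ∀ x, f (-x) = f x) (hi : Integrable f)
    (hi' : Integrable (complexFourier f)) :
    FourierSelfDual (fun x => f x + realFourier f x) where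
  continuous := hc.add (Complex.continuous_re.comp (continuous_complexFourier hi))
  even x := by rw [hf, realFourier, complexFourier_neg hf, realFourier]
  integrable := hi.add hi'.re
  fourier := by
    ext y
    have hr : Integrable (realFourier f) := hi'.re
    rw [complexFourier_add hi hr, complexFourier_realFourier hc hf hi hi',
      ← coe_realFourier hf]
    push_cast
    ring

theorem complexFourier_comp_smul {d : ℕ} (f : EuclideanSpace ℝ (Fin d) → ℝ) {c : ℝ}
    (hc : 0 < c) (y : EuclideanSpace ℝ (Fin d)) :
    complexFourier (fun x => f (c • x)) y = ((c ^ d)⁻¹ : ℝ) * complexFourier f (c⁻¹ • y) := by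
  simp only [complexFourier, Real.fourier_eq']
  have h := Measure.integral_comp_smul (volume : Measure (EuclideanSpace ℝ (Fin d)))
    (fun v => Complex.exp (↑(-2 * Real.pi * inner ℝ v (c⁻¹ • y)) * Complex.I) • (f v : ℂ)) c
  rw [finrank_euclideanSpace_fin, abs_of_pos (by positivity), Complex.real_smul] at h
  rw [← h]
  congr 1
  ext x
  rw [real_inner_smul_left, real_inner_smul_right, mul_inv_cancel_left₀ hc.ne']

/-! ### Symmetrized Gaussians -/

/-- The self-dual function `e^{-πt|x|²} + t^{-d/2} e^{-π|x|²/t}` as a function of `|x|`. -/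
noncomputable def gaussianPair (d : ℕ) (t r : ℝ) : ℝ :=
  Real.exp (-(Real.pi * t) * r ^ 2) + t ^ (-(d / 2) : ℝ) * Real.exp (-(Real.pi * t⁻¹) * r ^ 2)

theorem complexFourier_gaussian {d : ℕ} {t : ℝ} (ht : 0 < t) (y : EuclideanSpace ℝ (Fin d)) :
    complexFourier (fun x => Real.exp (-(Real.pi * t) * ‖x‖ ^ 2)) y =
      (t ^ (-(d / 2) : ℝ) * Real.exp (-(Real.pi * t⁻¹) * ‖y‖ ^ 2) : ℝ) := by
  have hpos : 0 < Real.pi * t := by positivity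
  have h := fourier_gaussian_innerProductSpace (V := EuclideanSpace ℝ (Fin d))
    (b := ((Real.pi * t : ℝ) : ℂ)) (by simpa using hpos) y
  rw [finrank_euclideanSpace_fin] at h
  have e1 : ((Real.pi : ℂ) / ((Real.pi * t : ℝ) : ℂ)) ^ ((d : ℂ) / 2) =
      ((t ^ (-(d / 2) : ℝ) : ℝ) : ℂ) := by
    rw [← Complex.ofReal_div, Real.rpow_neg ht.le, ← Real.inv_rpow ht.le,
      Complex.ofReal_cpow (by positivity)]
    congr 2
    · field_simp
    · push_cast; rfl
  rw [e1] at h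
  simp only [complexFourier]
  push_cast at h ⊢
  rw [h]
  congr 2
  have : (Real.pi : ℂ) ≠ 0 := by exact_mod_cast Real.pi_ne_zero
  have : (t : ℂ) ≠ 0 := by exact_mod_cast ht.ne'
  field_simp

theorem integrable_gaussian {d : ℕ} {t : ℝ} (ht : 0 < t) :
    Integrable (fun x : EuclideanSpace ℝ (Fin d) => Real.exp (-(Real.pi * t) * ‖x‖ ^ 2)) := by
  have hpos : 0 < Real.pi * t := by positivity
  have h := (GaussianFourier.integrable_cexp_neg_mul_sq_norm_add
    (V := EuclideanSpace ℝ (Fin d)) (b := ((Real.pi * t : ℝ) : ℂ)) (by simpa using hpos) 0 0).re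
  refine h.congr (Eventually.of_forall fun x => ?_)
  simp only [zero_mul, add_zero]
  rw [← Complex.ofReal_neg, ← Complex.ofReal_pow, ← Complex.ofReal_mul, ← Complex.ofReal_exp]
  exact Complex.ofReal_re _

theorem fourierSelfDual_gaussianPair (d : ℕ) {t : ℝ} (ht : 0 < t) :
    FourierSelfDual (fun x : EuclideanSpace ℝ (Fin d) => gaussianPair d t ‖x‖) := by
  have h : (fun x : EuclideanSpace ℝ (Fin d) => gaussianPair d t ‖x‖) =
      fun x => Real.exp (-(Real.pi * t) * ‖x‖ ^ 2) +
        realFourier (fun x => Real.exp (-(Real.pi * t) * ‖x‖ ^ 2)) x := by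
    ext x
    simp only [gaussianPair, realFourier, complexFourier_gaussian ht, Complex.ofReal_re]
  rw [h]
  refine FourierSelfDual.add_realFourier (by fun_prop) (by simp) (integrable_gaussian ht) ?_
  rw [funext (complexFourier_gaussian ht)]
  exact ((integrable_gaussian (inv_pos.2 ht)).const_mul _).ofReal

/-! ### Linear independence of evaluations at distinct radii -/

/-- Distinct positive `r` give distinct characters of the additive group `ℝ`, which are linearly
independent by Dedekind. -/
theorem eq_zero_of_sum_exp_eq_zero {S : Finset ℝ} (hS : ∀ r ∈ S, 0 < r) {a : ℝ → ℝ}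
    (h : ∀ t : ℝ, ∑ r ∈ S, a r * Real.exp (-(Real.pi * t) * r ^ 2) = 0) :
    ∀ r ∈ S, a r = 0 := by
  let φ : S → (Multiplicative ℝ →* ℝ) := fun r =>
    { toFun := fun t => Real.exp (-(Real.pi * t.toAdd) * (r : ℝ) ^ 2)
      map_one' := by simp
      map_mul' := fun x y => by
        rw [← Real.exp_add, toAdd_mul]
        congr 1
        ring }
  have hφ : Function.Injective φ := by
    intro r s hrs
    have h1 := DFunLike.congr_fun hrs (Multiplicative.ofAdd (1 : ℝ))
    simp only [φ, MonoidHom.coe_mk, OneHom.coe_mk, toAdd_ofAdd, Real.exp_eq_exp] at h1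
    have h2 : (r : ℝ) ^ 2 = (s : ℝ) ^ 2 :=
      mul_left_cancel₀ (by simp) h1
    exact Subtype.ext ((sq_eq_sq₀ (hS r r.2).le (hS s s.2).le).1 h2)
  have hli := (linearIndependent_monoidHom (Multiplicative ℝ) ℝ).comp φ hφ
  rw [Fintype.linearIndependent_iff] at hli
  intro r hr
  refine hli (fun r => a r) ?_ ⟨r, hr⟩
  ext t
  have := h t.toAdd
  rw [← Finset.sum_coe_sort] at this
  simpa [φ] using this

theorem tendsto_rpow_mul_exp_neg_inv (p : ℝ) {r : ℝ} (hr : 0 < r) :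
    Tendsto (fun t : ℝ => t ^ p * Real.exp (-(Real.pi * t⁻¹) * r ^ 2)) (𝓝[>] 0) (𝓝 0) := by
  have h := (tendsto_rpow_mul_exp_neg_mul_atTop_nhds_zero (-p) (Real.pi * r ^ 2)
    (by positivity)).comp (tendsto_inv_nhdsGT_zero (𝕜 := ℝ))
  refine h.congr' ?_
  filter_upwards [self_mem_nhdsWithin] with t ht
  have ht : 0 < t := ht
  simp only [Function.comp]
  rw [Real.inv_rpow ht.le, Real.rpow_neg ht.le, inv_inv]
  congr 2
  ring

/-- The sum `φ` of the terms `a r * exp (-π t r²)` is entire in `t`, and by hypothesis it is minus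
the sum of the terms with `1/t`, which decay faster than any power as `t → 0+`. So `φ` vanishes to
infinite order at `0`, hence identically. -/
theorem eq_zero_of_sum_gaussianPair_eq_zero_of_pos {d : ℕ} {S : Finset ℝ}
    (hS : ∀ r ∈ S, 0 < r) {a : ℝ → ℝ}
    (h : ∀ t : ℝ, 0 < t → ∑ r ∈ S, a r * gaussianPair d t r = 0) :
    ∀ r ∈ S, a r = 0 := by
  set φ : ℝ → ℝ := fun t => ∑ r ∈ S, a r * Real.exp (-(Real.pi * t) * r ^ 2) with hφ
  have han : AnalyticOnNhd ℝ φ Set.univ := by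
    intro t _
    simp only [hφ]
    fun_prop
  have hev : ∀ᶠ t in 𝓝 (0 : ℝ), φ t = 0 := by
    by_contra hne
    obtain ⟨n, g, hg, hg0, hfac⟩ :=
      (han 0 (Set.mem_univ _)).exists_eventuallyEq_pow_smul_nonzero_iff.2 hne
    have hlim : Tendsto (fun t : ℝ => -∑ r ∈ S, a r *
        (t ^ (-(n : ℝ) + -(d / 2) : ℝ) * Real.exp (-(Real.pi * t⁻¹) * r ^ 2)))
        (𝓝[>] 0) (𝓝 (-∑ r ∈ S, a r * 0)) :=
      (tendsto_finsetSum _ fun r hr =>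
        (tendsto_rpow_mul_exp_neg_inv _ (hS r hr)).const_mul (a r)).neg
    have hg' : Tendsto g (𝓝[>] 0) (𝓝 (g 0)) :=
      hg.continuousAt.tendsto.mono_left nhdsWithin_le_nhds
    apply hg0
    rw [tendsto_nhds_unique_of_eventuallyEq hg' hlim]
    · simp
    filter_upwards [self_mem_nhdsWithin, nhdsWithin_le_nhds hfac] with t ht hft
    have ht : 0 < t := ht
    have h1 := h t ht
    simp only [gaussianPair, mul_add, Finset.sum_add_distrib] at h1
    have h2 : t ^ n * g t = -∑ r ∈ S, a r *
        (t ^ (-(d / 2) : ℝ) * Real.exp (-(Real.pi * t⁻¹) * r ^ 2)) := by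
      rw [sub_zero, smul_eq_mul] at hft
      rw [← hft]
      exact eq_neg_of_add_eq_zero_left h1
    have h3 : g t = t ^ (-(n : ℝ)) * (t ^ n * g t) := by
      rw [Real.rpow_neg ht.le, Real.rpow_natCast, inv_mul_cancel_left₀ (by positivity)]
    rw [h3, h2, mul_neg, Finset.mul_sum]
    congr 1
    refine Finset.sum_congr rfl fun r _ => ?_
    rw [Real.rpow_add ht]
    ring
  have hzero : φ = 0 := han.eq_of_eventuallyEq (fun _ _ => analyticAt_const) hev
  exact eq_zero_of_sum_exp_eq_zero hS fun t => congrFun hzero t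

/-- Evaluations at distinct radii are linearly independent on the functions `gaussianPair d t`. -/
theorem eq_zero_of_sum_gaussianPair_eq_zero {d : ℕ} (hd : 1 ≤ d) {S : Finset ℝ}
    (hS : ∀ r ∈ S, 0 ≤ r) {a : ℝ → ℝ}
    (h : ∀ t : ℝ, 0 < t → ∑ r ∈ S, a r * gaussianPair d t r = 0) :
    ∀ r ∈ S, a r = 0 := by
  have hd' : (0 : ℝ) < d / 2 := by
    have : (1 : ℝ) ≤ d := by exact_mod_cast hd
    linarith
  -- Multiply the relation by `t ^ (d/2)` and let `t → 0+`: only the constant half of the pair at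
  -- radius `0` survives. This needs `d > 0`.
  have h0 : (0 : ℝ) ∈ S → a 0 = 0 := by
    intro h0S
    have hpow : Tendsto (fun t : ℝ => t ^ (d / 2 : ℝ)) (𝓝[>] 0) (𝓝 0) := by
      have := (Real.continuousAt_rpow_const 0 (d / 2 : ℝ) (Or.inr hd'.le)).tendsto
      rw [Real.zero_rpow hd'.ne'] at this
      exact this.mono_left nhdsWithin_le_nhds
    have hlim : ∀ r ∈ S, Tendsto (fun t : ℝ => a r *
        (t ^ (d / 2 : ℝ) * Real.exp (-(Real.pi * t) * r ^ 2) +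
          t ^ (0 : ℝ) * Real.exp (-(Real.pi * t⁻¹) * r ^ 2)))
        (𝓝[>] 0) (𝓝 (a r * (0 * 1 + if r = 0 then 1 else 0))) := by
      intro r hr
      refine ((hpow.mul ?_).add ?_).const_mul _
      · have hc : Continuous fun t : ℝ => Real.exp (-(Real.pi * t) * r ^ 2) := by fun_prop
        simpa using (hc.tendsto 0).mono_left nhdsWithin_le_nhds
      · split_ifs with hr0
        · simp [hr0]
        · exact tendsto_rpow_mul_exp_neg_inv 0 (lt_of_le_of_ne (hS r hr) (Ne.symm hr0))
    have hsum := tendsto_finsetSum S hlim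
    have hsum0 : Tendsto (fun _ : ℝ => (0 : ℝ)) (𝓝[>] 0) (𝓝 0) := tendsto_const_nhds
    have := tendsto_nhds_unique_of_eventuallyEq hsum hsum0 (by
      filter_upwards [self_mem_nhdsWithin] with t ht
      have ht : 0 < t := ht
      have h1 := congrArg (t ^ (d / 2 : ℝ) * ·) (h t ht)
      simp only [mul_zero, Finset.mul_sum] at h1
      refine Eq.trans (Finset.sum_congr rfl fun r _ => ?_) h1
      rw [gaussianPair, Real.rpow_zero, Real.rpow_neg ht.le]
      have : t ^ (d / 2 : ℝ) ≠ 0 := (Real.rpow_pos_of_pos ht _).ne'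
      field_simp)
    simpa [h0S] using this
  have hpos : ∀ r ∈ S.erase 0, a r = 0 := by
    refine eq_zero_of_sum_gaussianPair_eq_zero_of_pos (d := d) (fun r hr => ?_) fun t ht => ?_
    · rw [Finset.mem_erase] at hr
      exact lt_of_le_of_ne (hS r hr.2) (Ne.symm hr.1)
    · refine (Finset.sum_subset (Finset.erase_subset _ _) fun r hr hr' => ?_).trans (h t ht)
      obtain rfl : r = 0 := by
        by_contra hne
        exact hr' (Finset.mem_erase.2 ⟨hne, hr⟩)
      rw [h0 hr, zero_mul]
  intro r hr
  by_cases hr0 : r = 0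
  · subst hr0; exact h0 hr
  · exact hpos r (Finset.mem_erase.2 ⟨hr0, hr⟩)

/-! ### Self-dual functions with prescribed values -/

theorem span_gaussianPair_eq_top {d : ℕ} (hd : 1 ≤ d) {S : Finset ℝ} (hS : ∀ r ∈ S, 0 ≤ r) :
    Submodule.span ℝ ((fun (t : ℝ) (r : S) => gaussianPair d t r) '' Set.Ioi 0) = ⊤ := by
  classical
  by_contra hne
  obtain ⟨l, hl, hl'⟩ := Submodule.exists_dual_map_eq_bot_of_lt_top
    (lt_top_iff_ne_top.2 hne) inferInstance
  apply hl
  let a : ℝ → ℝ := fun r => if hr : r ∈ S then l (Pi.single ⟨r, hr⟩ 1) else 0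
  have ha : ∀ r : S, a r = l (Pi.single r 1) := fun r => by simp [a]
  have hz : ∀ r ∈ S, a r = 0 := by
    refine eq_zero_of_sum_gaussianPair_eq_zero hd hS fun t ht => ?_
    have h1 : l (fun r : S => gaussianPair d t r) = 0 := by
      rw [← Submodule.mem_bot ℝ, ← hl']
      exact Submodule.mem_map_of_mem (Submodule.subset_span ⟨t, ht, rfl⟩)
    rw [LinearMap.pi_apply_eq_sum_univ] at h1
    rw [← Finset.sum_coe_sort, ← h1]
    refine Finset.sum_congr rfl fun r _ => ?_
    rw [ha, smul_eq_mul, mul_comm]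
    congr 2
    ext j
    simp [Pi.single_apply, eq_comm]
  refine LinearMap.pi_ext' fun r => LinearMap.ext_ring ?_
  simpa [hz r r.2] using (ha r).symm

/-- A self-dual function that is continuous and has Gaussian decay, with prescribed values at
finitely many radii. -/
theorem exists_fourierSelfDual_eq {d : ℕ} (hd : 1 ≤ d) {S : Finset ℝ} (hS : ∀ r ∈ S, 0 ≤ r)
    (v : ℝ → ℝ) : ∃ h : ℝ → ℝ, Continuous h ∧
      FourierSelfDual (fun x : EuclideanSpace ℝ (Fin d) => h ‖x‖) ∧
      (∃ τ > 0, ∃ C, ∀ r, |h r| ≤ C * Real.exp (-(Real.pi * τ) * r ^ 2)) ∧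
      ∀ r ∈ S, h r = v r := by
  have hexp : ∀ {σ τ : ℝ}, σ ≤ τ → ∀ r : ℝ,
      Real.exp (-(Real.pi * τ) * r ^ 2) ≤ Real.exp (-(Real.pi * σ) * r ^ 2) := by
    intro σ τ hστ r
    have := mul_le_mul_of_nonneg_right (mul_le_mul_of_nonneg_left hστ Real.pi_pos.le)
      (sq_nonneg r)
    exact Real.exp_le_exp.2 (by linarith)
  suffices H : ∀ w : S → ℝ, ∃ h : ℝ → ℝ, Continuous h ∧
      FourierSelfDual (fun x : EuclideanSpace ℝ (Fin d) => h ‖x‖) ∧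
      (∃ τ > 0, ∃ C, ∀ r, |h r| ≤ C * Real.exp (-(Real.pi * τ) * r ^ 2)) ∧
      ∀ r : S, h r = w r by
    obtain ⟨h, h1, h2, h3, h4⟩ := H fun r => v r
    exact ⟨h, h1, h2, h3, fun r hr => h4 ⟨r, hr⟩⟩
  intro w
  have hw : w ∈ Submodule.span ℝ ((fun (t : ℝ) (r : S) => gaussianPair d t r) '' Set.Ioi 0) := by
    rw [span_gaussianPair_eq_top hd hS]
    trivial
  induction hw using Submodule.span_induction with
  | mem w hw =>
    obtain ⟨t, ht, rfl⟩ := hw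
    have ht : 0 < t := ht
    refine ⟨gaussianPair d t, ?_, fourierSelfDual_gaussianPair d ht,
      ⟨min t t⁻¹, by positivity, 1 + t ^ (-(d / 2) : ℝ), fun r => ?_⟩, fun _ => rfl⟩
    · unfold gaussianPair
      fun_prop
    · have := Real.rpow_pos_of_pos ht (-(d / 2) : ℝ)
      rw [gaussianPair, abs_of_pos (by positivity), add_mul, one_mul]
      exact add_le_add (hexp (min_le_left _ _) r)
        (mul_le_mul_of_nonneg_left (hexp (min_le_right _ _) r) this.le)
  | zero =>
    refine ⟨fun _ => 0, continuous_const, ?_, ⟨1, one_pos, 0, by simp⟩, by simp⟩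
    simpa using (fourierSelfDual_gaussianPair d one_pos).const_mul 0
  | add w₁ w₂ _ _ ih₁ ih₂ =>
    obtain ⟨h₁, hc₁, hs₁, ⟨τ₁, hτ₁, C₁, hC₁⟩, he₁⟩ := ih₁
    obtain ⟨h₂, hc₂, hs₂, ⟨τ₂, hτ₂, C₂, hC₂⟩, he₂⟩ := ih₂
    refine ⟨fun r => h₁ r + h₂ r, hc₁.add hc₂, hs₁.add hs₂,
      ⟨min τ₁ τ₂, lt_min hτ₁ hτ₂, |C₁| + |C₂|, fun r => ?_⟩, fun r => by simp [he₁, he₂]⟩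
    refine (abs_add_le _ _).trans ?_
    rw [add_mul]
    refine add_le_add ((hC₁ r).trans ?_) ((hC₂ r).trans ?_)
    · exact mul_le_mul (le_abs_self _) (hexp (min_le_left _ _) r) (Real.exp_pos _).le
        (abs_nonneg _)
    · exact mul_le_mul (le_abs_self _) (hexp (min_le_right _ _) r) (Real.exp_pos _).le
        (abs_nonneg _)
  | smul c w _ ih =>
    obtain ⟨h, hc, hs, ⟨τ, hτ, C, hC⟩, he⟩ := ih
    refine ⟨fun r => c * h r, hc.const_mul c, hs.const_mul c, ⟨τ, hτ, |c| * C, fun r => ?_⟩,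
      fun r => by simp [he]⟩
    rw [abs_mul, mul_assoc]
    exact mul_le_mul_of_nonneg_left (hC r) (abs_nonneg c)

/-- A radial self-dual function that is nonpositive at the origin, and positive at infinity and
at finitely many prescribed radii. -/
theorem exists_fourierSelfDual_pos {d : ℕ} (hd : 1 ≤ d) {S : Finset ℝ} (hS : ∀ r ∈ S, 0 < r) :
    ∃ h : ℝ → ℝ, Continuous h ∧
      FourierSelfDual (fun x : EuclideanSpace ℝ (Fin d) => h ‖x‖) ∧ h 0 ≤ 0 ∧
      (∀ r ∈ S, 0 < h r) ∧ ∃ R, ∀ r, R < r → 0 < h r := by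
  -- The value `-1` at the origin leaves room for adding a positive function of value `1` there.
  obtain ⟨h, hc, hs, ⟨τ, hτ, C, hC⟩, he⟩ := exists_fourierSelfDual_eq hd (S := insert 0 S)
    (by simpa using fun r hr => (hS r hr).le) (fun r => if r = 0 then -1 else 1)
  -- A Gaussian pair at half the decay rate dominates `h` at infinity.
  set σ := τ / 2 with hσ
  have hσ0 : 0 < σ := by positivity
  have hg0 : 0 < gaussianPair d σ 0 := by
    have := Real.rpow_pos_of_pos hσ0 (-(d / 2) : ℝ)
    unfold gaussianPair
    positivity
  set η := (gaussianPair d σ 0)⁻¹ with hη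
  have hη0 : 0 < η := inv_pos.2 hg0
  have hge : ∀ r, Real.exp (-(Real.pi * σ) * r ^ 2) ≤ gaussianPair d σ r := by
    intro r
    have := Real.rpow_pos_of_pos hσ0 (-(d / 2) : ℝ)
    unfold gaussianPair
    exact le_add_of_nonneg_right (by positivity)
  refine ⟨fun r => h r + η * gaussianPair d σ r, ?_,
    hs.add ((fourierSelfDual_gaussianPair d hσ0).const_mul η), ?_, fun r hr => ?_, ?_⟩
  · unfold gaussianPair
    fun_prop
  · simp only
    rw [he 0 (Finset.mem_insert_self _ _), hη, inv_mul_cancel₀ hg0.ne']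
    simp
  · simp only
    rw [he r (Finset.mem_insert_of_mem hr), if_neg (hS r hr).ne']
    have := (Real.exp_pos _).trans_le (hge r)
    positivity
  · have hlim : Tendsto (fun r : ℝ => Real.exp (Real.pi * σ * r ^ 2)) atTop atTop :=
      Real.tendsto_exp_atTop.comp
        ((tendsto_pow_atTop two_ne_zero).const_mul_atTop (by positivity))
    obtain ⟨R, hR⟩ := eventually_atTop.1 (hlim.eventually_gt_atTop (C / η))
    refine ⟨R, fun r hr => ?_⟩
    have h1 := (div_lt_iff₀' hη0).1 (hR r hr.le)
    have h2 := (abs_le.1 (hC r)).1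
    have h3 : C * Real.exp (-(Real.pi * τ) * r ^ 2) <
        η * Real.exp (Real.pi * σ * r ^ 2) * Real.exp (-(Real.pi * τ) * r ^ 2) :=
      mul_lt_mul_of_pos_right h1 (Real.exp_pos _)
    rw [mul_assoc, ← Real.exp_add,
      show Real.pi * σ * r ^ 2 + -(Real.pi * τ) * r ^ 2 = -(Real.pi * σ) * r ^ 2 by
        rw [hσ]; ring] at h3
    have h4 := mul_le_mul_of_nonneg_left (hge r) hη0.le
    linarith

/-! ### The radius `A(f)` and the constant `𝐀` -/

theorem nonneg_of_nonnegRadius_lt {d : ℕ} {f : EuclideanSpace ℝ (Fin d) → ℝ}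
    {x : EuclideanSpace ℝ (Fin d)} (h : nonnegRadius f < ENNReal.ofReal ‖x‖) : 0 ≤ f x := by
  simp only [nonnegRadius, iInf_lt_iff] at h
  obtain ⟨r, ⟨-, hr⟩, hrx⟩ := h
  rw [← ENNReal.ofReal_coe_nnreal] at hrx
  exact hr x (ENNReal.ofReal_lt_ofReal_iff'.1 hrx).1

theorem nonnegRadius_le {d : ℕ} {f : EuclideanSpace ℝ (Fin d) → ℝ} {r : ℝ} (hr : 0 < r)
    (h : ∀ x, r < ‖x‖ → 0 ≤ f x) : nonnegRadius f ≤ ENNReal.ofReal r := by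
  refine iInf₂_le r.toNNReal ⟨Real.toNNReal_pos.2 hr, fun x hx => h x ?_⟩
  rwa [Real.coe_toNNReal r hr.le] at hx

theorem FourierSelfDual.sharpConst_le {d : ℕ} {f : EuclideanSpace ℝ (Fin d) → ℝ}
    (hf : FourierSelfDual f) (h0 : f 0 ≤ 0) (hne : f ≠ 0) {r : ℝ} (hr : 0 < r)
    (h : ∀ x, r < ‖x‖ → 0 ≤ f x) : sharpConst d ≤ ENNReal.ofReal r := by
  refine (iInf₂_le f (hf.admissible h0 hne)).trans ?_
  rw [hf.realFourier_eq, ← pow_two, ← ENNReal.rpow_natCast, ← ENNReal.rpow_mul]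
  simpa using nonnegRadius_le hr h

theorem Admissible.realFourier {d : ℕ} {f : EuclideanSpace ℝ (Fin d) → ℝ} (hf : Admissible f) :
    Admissible (realFourier f) := by
  have hff := complexFourier_realFourier hf.continuous hf.even hf.integrable
    hf.integrable_fourier
  refine ⟨Complex.continuous_re.comp (continuous_complexFourier hf.integrable),
    fun x => by rw [_root_.realFourier, complexFourier_neg hf.even, _root_.realFourier],
    fun h0 => hf.ne_zero ?_, hf.integrable_fourier.re, ?_, hf.fourier_zero_nonpos, ?_⟩
  · ext y
    have := hff y
    rw [h0] at this
    simpa [complexFourier, Real.fourier_eq', eq_comm] using this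
  · rw [funext hff]
    exact hf.integrable.ofReal
  · rw [_root_.realFourier, hff, Complex.ofReal_re]
    exact hf.apply_zero_nonpos

/-- Radius `0` would make `f` nonnegative everywhere by continuity, while its integral is `f̂(0) ≤
0`; this forces `f = 0`. -/
theorem Admissible.nonnegRadius_ne_zero {d : ℕ} (hd : 1 ≤ d)
    {f : EuclideanSpace ℝ (Fin d) → ℝ} (hf : Admissible f) : nonnegRadius f ≠ 0 := by
  intro h0
  have : Nonempty (Fin d) := ⟨⟨0, hd⟩⟩
  have hpos : 0 ≤ f := by
    have hcl : IsClosed {x | 0 ≤ f x} := isClosed_le continuous_const hf.continuous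
    have hsub : ({0}ᶜ : Set (EuclideanSpace ℝ (Fin d))) ⊆ {x | 0 ≤ f x} := by
      intro x hx
      refine nonneg_of_nonnegRadius_lt ?_
      rw [h0]
      simpa using hx
    have hd0 : Dense ({0}ᶜ : Set (EuclideanSpace ℝ (Fin d))) := dense_compl_singleton 0
    intro x
    exact hcl.closure_subset_iff.2 hsub (hd0 x)
  have hint : ∫ x, f x = _root_.realFourier f 0 := by
    simp only [_root_.realFourier, complexFourier, Real.fourier_eq', inner_zero_right, mul_zero,
      Complex.ofReal_zero, zero_mul, Complex.exp_zero, one_smul]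
    rw [integral_complex_ofReal, Complex.ofReal_re]
  have hz : ∫ x, f x = 0 :=
    le_antisymm (hint ▸ hf.fourier_zero_nonpos) (integral_nonneg hpos)
  rw [integral_eq_zero_iff_of_nonneg hpos hf.integrable] at hz
  exact hf.ne_zero ((hf.continuous.ae_eq_iff_eq volume continuous_zero).1 hz)

theorem sharpConst_ne_top {d : ℕ} (hd : 1 ≤ d) : sharpConst d ≠ ⊤ := by
  have : Nonempty (Fin d) := ⟨⟨0, hd⟩⟩
  obtain ⟨h, -, hs, h0, -, R, hR⟩ := exists_fourierSelfDual_pos hd (S := ∅) (by simp)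
  refine ne_top_of_le_ne_top ENNReal.ofReal_ne_top
    (hs.sharpConst_le (by simpa using h0) (fun hz => ?_) (r := max R 1) (by positivity)
      fun x hx => (hR _ ((le_max_left _ _).trans_lt hx)).le)
  obtain ⟨x, hx⟩ := NormedSpace.exists_lt_norm ℝ (EuclideanSpace ℝ (Fin d)) R
  exact (hR _ hx).ne' (congrFun hz x)

/-! ### Perturbation -/

/-- A self-dual function that is nonnegative outside a ball and vanishes there on finitely many
spheres only can be perturbed so as to shrink the ball. -/
theorem FourierSelfDual.sharpConst_lt {d : ℕ} (hd : 1 ≤ d) {g : EuclideanSpace ℝ (Fin d) → ℝ}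
    (hg : FourierSelfDual g) (hg0 : g 0 ≤ 0) {s : ℝ} (hs : 0 < s)
    (hpos : ∀ x, s < ‖x‖ → 0 ≤ g x) {Z : Set ℝ} (hZ : Z.Finite)
    (hzero : ∀ x, s < ‖x‖ → g x = 0 → ‖x‖ ∈ Z) : sharpConst d < ENNReal.ofReal s := by
  classical
  have : Nonempty (Fin d) := ⟨⟨0, hd⟩⟩
  -- The radius `s` is included because `g` may vanish on that sphere.
  obtain ⟨h, hc, hsd, h0, hS, R, hR⟩ := exists_fourierSelfDual_pos hd
    (S := insert s (hZ.toFinset.filter (s < ·))) (by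
      intro r hr
      rcases Finset.mem_insert.1 hr with rfl | hr
      · exact hs
      · exact hs.trans (Finset.mem_filter.1 hr).2)
  have hhs : 0 < h s := hS s (Finset.mem_insert_self _ _)
  have hpos' : ∀ x, s ≤ ‖x‖ → 0 ≤ g x := by
    intro x hx
    have hlim : Tendsto (fun c : ℝ => g (c • x)) (𝓝[>] 1) (𝓝 (g x)) := by
      have hcont : Continuous fun c : ℝ => g (c • x) := hg.continuous.comp (by fun_prop)
      simpa using (hcont.tendsto 1).mono_left nhdsWithin_le_nhds
    refine ge_of_tendsto hlim ?_
    filter_upwards [self_mem_nhdsWithin] with c hc1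
    have hc1 : 1 < c := hc1
    refine hpos _ (hx.trans_lt ?_)
    rw [norm_smul, Real.norm_of_nonneg (by linarith)]
    exact lt_mul_of_one_lt_left (hs.trans_le hx) hc1
  -- The only region in `|x| ≥ s` where `h` could hurt; it is compact and avoids the zeros of `g`.
  let K : Set (EuclideanSpace ℝ (Fin d)) :=
    Metric.closedBall 0 R ∩ {x | s ≤ ‖x‖ ∧ h ‖x‖ ≤ 0}
  have hK : IsCompact K := (isCompact_closedBall 0 R).inter_right
    ((isClosed_le continuous_const continuous_norm).inter
      (isClosed_le (hc.comp continuous_norm) continuous_const))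
  have hKpos : ∀ x ∈ K, 0 < g x := by
    rintro x ⟨-, hsx, hhx⟩
    have hlt : s < ‖x‖ := lt_of_le_of_ne hsx fun he => by
      rw [← he] at hhx
      exact absurd hhs hhx.not_gt
    refine lt_of_le_of_ne (hpos x hlt) fun he => hhx.not_gt (hS _ ?_)
    exact Finset.mem_insert_of_mem
      (Finset.mem_filter.2 ⟨hZ.mem_toFinset.2 (hzero x hlt he.symm), hlt⟩)
  obtain ⟨m, hm, hmK⟩ := hK.exists_forall_le' hg.continuous.continuousOn hKpos
  obtain ⟨C, hC⟩ := hK.exists_bound_of_continuousOn (hc.comp continuous_norm).continuousOn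
  -- Chosen so that `ε * |C| < m`, with `m` a positive lower bound of `g` on `K`.
  set ε := m / (|C| + 1) with hε
  have hε0 : 0 < ε := by positivity
  have hG : FourierSelfDual (fun x => g x + ε * h ‖x‖) := hg.add (hsd.const_mul ε)
  have hGpos : ∀ x, s ≤ ‖x‖ → 0 < g x + ε * h ‖x‖ := by
    intro x hx
    rcases lt_or_ge 0 (h ‖x‖) with hhx | hhx
    · have := hpos' x hx
      positivity
    · have hxR : ‖x‖ ≤ R := not_lt.1 fun hlt => hhx.not_gt (hR _ hlt)
      have hxK : x ∈ K := ⟨by simpa using hxR, hx, hhx⟩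
      have h1 := (abs_le.1 (hC x hxK)).1
      have h2 : ε * (|C| + 1) = m := div_mul_cancel₀ _ (by positivity)
      have h3 := hmK x hxK
      have h4 : ε * -|C| ≤ ε * h ‖x‖ :=
        mul_le_mul_of_nonneg_left ((neg_le_neg (le_abs_self C)).trans h1) hε0.le
      linarith
  -- By compactness, the points where the perturbation is not positive stay at norm at most `-b <
  -- s`.
  let M : Set (EuclideanSpace ℝ (Fin d)) :=
    Metric.closedBall 0 s ∩ {x | g x + ε * h ‖x‖ ≤ 0}
  have hM : IsCompact M := (isCompact_closedBall 0 s).inter_right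
    (isClosed_le hG.continuous continuous_const)
  obtain ⟨b, hb, hbM⟩ := hM.exists_forall_le' (f := fun x => -‖x‖) (a := -s)
    continuous_norm.neg.continuousOn fun x hx => by
      refine neg_lt_neg (not_le.1 fun hle => ?_)
      exact (hGpos x hle).not_ge hx.2
  have hlt : max (-b) (s / 2) < s := max_lt (by linarith) (by linarith)
  refine (hG.sharpConst_le ?_ (fun hz => ?_) (r := max (-b) (s / 2)) (by positivity)
    fun x hx => ?_).trans_lt ((ENNReal.ofReal_lt_ofReal_iff hs).2 hlt)
  · simpa using add_nonpos hg0 (mul_nonpos_of_nonneg_of_nonpos hε0.le h0)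
  · obtain ⟨x, hx⟩ := NormedSpace.exists_lt_norm ℝ (EuclideanSpace ℝ (Fin d)) s
    exact (hGpos x hx.le).ne' (congrFun hz x)
  · by_contra! hneg
    have hxs : ‖x‖ ≤ s := not_lt.1 fun h => (hGpos x h.le).not_gt hneg
    have := hbM x ⟨by simpa using hxs, hneg.le⟩
    have h1 := (le_max_left (-b) (s / 2)).trans_lt hx
    linarith

/-! ### Symmetrization and conclusion -/

theorem Admissible.comp_smul {d : ℕ} {f : EuclideanSpace ℝ (Fin d) → ℝ} (hf : Admissible f)
    {c : ℝ} (hc : 0 < c) : FourierSelfDual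
      (fun x => f (c • x) + (c ^ d)⁻¹ * _root_.realFourier f (c⁻¹ • x)) := by
  have hfou := complexFourier_comp_smul f hc
  have h : _root_.realFourier (fun x => f (c • x)) =
      fun x => (c ^ d)⁻¹ * _root_.realFourier f (c⁻¹ • x) := by
    ext x
    rw [_root_.realFourier, hfou, Complex.re_ofReal_mul, _root_.realFourier]
  have hsum := FourierSelfDual.add_realFourier (f := fun x => f (c • x))
    (hf.continuous.comp (continuous_const_smul c)) (fun x => by rw [smul_neg, hf.even])
    (hf.integrable.comp_smul hc.ne') (by
      rw [funext hfou]
      exact (hf.integrable_fourier.comp_smul (inv_ne_zero hc.ne')).const_mul _)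
  rwa [h] at hsum

theorem theorem1p4 (d : ℕ) (hd : 1 ≤ d) (f : ℝ≥0 → ℝ)
    (hf : Admissible (radialExtension d f))
    (hext : nonnegRadius (radialExtension d f) *
        nonnegRadius (realFourier (radialExtension d f)) = sharpConst d ^ 2) :
    {x : ℝ≥0 | nonnegRadius (radialExtension d f) < (x : ℝ≥0∞) ∧ IsDoubleRoot f x}.Infinite := by
  have : Nonempty (Fin d) := ⟨⟨0, hd⟩⟩
  set F := radialExtension d f with hF
  have hnonneg : ∀ r : ℝ≥0, nonnegRadius F < (r : ℝ≥0∞) → 0 ≤ f r := by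
    intro r hr
    obtain ⟨x, hx⟩ := exists_norm_eq (EuclideanSpace ℝ (Fin d)) r.coe_nonneg
    have hxr : ‖x‖₊ = r := NNReal.eq hx
    have := nonneg_of_nonnegRadius_lt (f := F) (x := x) (by
      rwa [hx, ENNReal.ofReal_coe_nnreal])
    rwa [hF, radialExtension, hxr] at this
  intro hfin
  have ha0 := hf.nonnegRadius_ne_zero hd
  have hb0 := hf.realFourier.nonnegRadius_ne_zero hd
  have hab : nonnegRadius F * nonnegRadius (realFourier F) ≠ ⊤ := by
    rw [hext]
    exact ENNReal.pow_ne_top (sharpConst_ne_top hd)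
  have haT : nonnegRadius F ≠ ⊤ := fun h => hab (by rw [h, ENNReal.top_mul hb0])
  have hbT : nonnegRadius (realFourier F) ≠ ⊤ := fun h => hab (by rw [h, ENNReal.mul_top ha0])
  set a := (nonnegRadius F).toReal with ha
  set b := (nonnegRadius (realFourier F)).toReal with hb
  have hapos : 0 < a := ENNReal.toReal_pos ha0 haT
  have hbpos : 0 < b := ENNReal.toReal_pos hb0 hbT
  have hFpos : ∀ x, a < ‖x‖ → 0 ≤ F x := fun x hx =>
    nonneg_of_nonnegRadius_lt ((ENNReal.lt_ofReal_iff_toReal_lt haT).2 hx)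
  have hFpos' : ∀ x, b < ‖x‖ → 0 ≤ realFourier F x := fun x hx =>
    nonneg_of_nonnegRadius_lt ((ENNReal.lt_ofReal_iff_toReal_lt hbT).2 hx)
  -- The dilation that balances the radii: `a / c = c * b = s`.
  set c := √(a / b) with hc
  set s := √(a * b) with hs
  have hcpos : 0 < c := Real.sqrt_pos.2 (by positivity)
  have hspos : 0 < s := Real.sqrt_pos.2 (by positivity)
  have hcs : c * s = a := by
    rw [hc, hs, ← Real.sqrt_mul (by positivity), show a / b * (a * b) = a * a by field_simp,
      Real.sqrt_mul_self hapos.le]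
  have hcs' : c⁻¹ * s = b := by
    rw [hc, hs, ← Real.sqrt_inv, ← Real.sqrt_mul (by positivity),
      show (a / b)⁻¹ * (a * b) = b * b by field_simp, Real.sqrt_mul_self hbpos.le]
  have hnorm : ∀ x : EuclideanSpace ℝ (Fin d), s < ‖x‖ → a < ‖c • x‖ ∧ b < ‖c⁻¹ • x‖ := by
    intro x hx
    rw [norm_smul, norm_smul, Real.norm_of_nonneg hcpos.le,
      Real.norm_of_nonneg (inv_pos.2 hcpos).le]
    nth_rewrite 1 [← hcs]
    rw [← hcs']
    exact ⟨mul_lt_mul_of_pos_left hx hcpos, mul_lt_mul_of_pos_left hx (inv_pos.2 hcpos)⟩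
  have hcd : 0 < (c ^ d)⁻¹ := by positivity
  have hlt : sharpConst d < ENNReal.ofReal s := by
    refine (hf.comp_smul hcpos).sharpConst_lt hd ?_ hspos (fun x hx => ?_)
      (hfin.image fun r : ℝ≥0 => c⁻¹ * r) fun x hx hx0 => ?_
    · simpa using add_nonpos hf.apply_zero_nonpos
        (mul_nonpos_of_nonneg_of_nonpos hcd.le hf.fourier_zero_nonpos)
    · exact add_nonneg (hFpos _ (hnorm x hx).1) (mul_nonneg hcd.le (hFpos' _ (hnorm x hx).2))
    · have h1 := hFpos _ (hnorm x hx).1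
      have h2 := mul_nonneg hcd.le (hFpos' _ (hnorm x hx).2)
      have h3 : F (c • x) = 0 := by linarith
      have h4 : nonnegRadius F < (‖c • x‖₊ : ℝ≥0∞) := by
        rw [← ENNReal.ofReal_coe_nnreal, coe_nnnorm]
        exact (ENNReal.lt_ofReal_iff_toReal_lt haT).2 (hnorm x hx).1
      -- A zero strictly beyond `A(F)` has a neighbourhood on which `f ≥ 0`, so it is a double root.
      refine ⟨‖c • x‖₊, ⟨h4, h3, Or.inl ?_⟩, ?_⟩
      · filter_upwards [ENNReal.continuous_coe.continuousAt.eventually_const_lt h4] with r hr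
        exact hnonneg r hr
      · simp only [coe_nnnorm]
        rw [norm_smul, Real.norm_of_nonneg hcpos.le, inv_mul_cancel_left₀ hcpos.ne']
  have hsq : sharpConst d ^ 2 = ENNReal.ofReal s ^ 2 := by
    rw [← hext, ← ENNReal.ofReal_pow hspos.le, hs, Real.sq_sqrt (by positivity),
      ENNReal.ofReal_mul hapos.le, ha, hb, ENNReal.ofReal_toReal haT, ENNReal.ofReal_toReal hbT]
  exact (ENNReal.pow_lt_pow_left two_ne_zero hlt).ne hsq
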